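/- For $n\ge 1$ and $0\le\alpha<1$ let $M_\alpha(n)$ be the maximum number of lines through the origin in $\mathbb{R}^n$ any two distinct ones of which meet at the angle $\arccos\alpha$; equivalently, the maximum cardinality of a finite set $X$ of unit vectors in $\mathbb{R}^n$ with $\langle x,y\rangle\in\{\alpha,-\alpha\}$ for all distinct $x,y\in X$. For an integer $k\ge 2$ put $n_k := 3(2k-1)^2-4$ and $\alpha_k := \sqrt{3/(n_k+4)}$. Then, for every integer $k\ge 2$, $\alpha_k = 1/(2k-1)$, the maximum $M_{\alpha_k}(n_k)$ is finite, and $$M_{\alpha_k}(n_k)\le 2(k-1)(4k^3-k-1) < \frac{(n_k+1)(n_k+2)}{6}.$$ -/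

import Mathlib

/-- A set `L` of lines through the origin of `ℝⁿ` (one-dimensional subspaces) is an equiangular
line system with common angle `arccos α` (`0 ≤ α < 1`) if any two distinct lines of `L` meet at
that angle, that is, `|⟪u, v⟫| = α` for unit vectors `u`, `v` spanning the two lines. -/
def IsEquiangularLineSystem (n : ℕ) (α : ℝ)
    (L : Set (Submodule ℝ (EuclideanSpace ℝ (Fin n)))) : Prop :=
  (∀ l ∈ L, Module.finrank ℝ l = 1) ∧
    ∀ l ∈ L, ∀ l' ∈ L, l ≠ l' → ∀ u ∈ l, ∀ v ∈ l', ‖u‖ = 1 → ‖v‖ = 1 → |inner ℝ u v| = α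

/-- `M_α(n)`: the maximum number of equiangular lines in `ℝⁿ` with common angle `arccos α`, as the
supremum in `ℕ∞` of the cardinalities of all such line systems (so that no junk value arises). -/
noncomputable def maxEquiangularLines (α : ℝ) (n : ℕ) : ℕ∞ :=
  ⨆ (L : Set (Submodule ℝ (EuclideanSpace ℝ (Fin n)))) (_ : IsEquiangularLineSystem n α L), L.encard

/-- `n_k = 3(2k-1)² - 4`; no subtraction is truncated for `k ≥ 2`. -/
def dimSeq (k : ℕ) : ℕ := 3 * (2 * k - 1) ^ 2 - 4

/-- `α_k = √(3 / (n_k + 4))`. -/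
noncomputable def cosSeq (k : ℕ) : ℝ := Real.sqrt (3 / ((dimSeq k : ℝ) + 4))

/-!
The bound comes from fixing one line of the system and looking at all the others from there.
Put `a = 2k - 1`, so that the common angle is `arccos (1 / a)` and the dimension is `3a² - 4`. Let
`z` be a unit vector on the fixed line, and on every other line take the unit vector `x` with
`⟪x, z⟫ = 1 / a`. The vectors `q = a x - z` lie in the orthogonal complement of `z`, of
dimension `d = 3a² - 5`; they satisfy `‖q‖² = a² - 1`, and any two of them have inner product
`a - 1` or `-(a + 1)`.

The third Gegenbauer polynomial is a positive definite kernel on the sphere: for vectors with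
`‖q‖² = c` in dimension `d`, the sum of `(d + 2) t³ - 3 c² t` over all inner products `t` is
nonnegative (`three_mul_sum_inner_le`). Here this says `∑ (t³ - (a² - 1) t) ≥ 0`. In
dimension `3a² - 4` the summand is negative at both off-diagonal values, being at most
`-2(a - 1)²`, so the diagonal terms limit the number `N` of vectors:
`2 (N - 1) ≤ (a² - 2) (a + 1)²` (`two_mul_card_sub_one_le`). Adding the fixed line gives the
stated bound.
-/

/-- Positivity of the third Gegenbauer kernel, in coordinates. With `T = ∑ x ⊗ x ⊗ x` and
`w = ∑ x`, it is the inequality `‖T - P‖² ≥ 0` where `P` is the projection of `T` to the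
line spanned by the symmetrization of `w ⊗ δ`. -/
theorem three_mul_sum_dotProduct_le {ι κ : Type*} [Fintype ι] [Fintype κ]
    (x : ι → κ → ℝ) (c : ℝ) (hx : ∀ i, ∑ l, x i l * x i l = c) :
    3 * c ^ 2 * ∑ i, ∑ j, ∑ l, x i l * x j l ≤
      (Fintype.card κ + 2) * ∑ i, ∑ j, (∑ l, x i l * x j l) ^ 3 := by
  classical
  -- `w` is the sum of the vectors, `T` the sum of their tensor cubes, `W = ‖w‖²`.
  set w : κ → ℝ := fun l => ∑ i, x i l with hw
  set T : κ → κ → κ → ℝ := fun l m n => ∑ i, x i l * x i m * x i n with hT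
  set W : ℝ := ∑ l, w l * w l with hW
  set D : ℝ := (Fintype.card κ : ℝ) with hD
  let δ : κ → κ → ℝ := fun l m => if l = m then 1 else 0
  have hgram : ∑ i, ∑ j, ∑ l, x i l * x j l = W := by
    simp only [hW, hw, Finset.sum_mul_sum]
    conv_rhs => rw [Finset.sum_comm]
    refine Finset.sum_congr rfl fun i _ => ?_
    rw [Finset.sum_comm]
  have hTT : ∑ l, ∑ m, ∑ n, T l m n * T l m n = ∑ i, ∑ j, (∑ l, x i l * x j l) ^ 3 := by
    have hcube : ∀ i j, (∑ l, x i l * x j l) ^ 3 =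
        ∑ l, ∑ m, ∑ n, (x i l * x i m * x i n) * (x j l * x j m * x j n) := by
      intro i j
      rw [pow_succ, pow_two, Finset.sum_mul_sum, Finset.sum_mul]
      refine Finset.sum_congr rfl fun l _ => ?_
      rw [Finset.sum_mul_sum]
      exact Finset.sum_congr rfl fun m _ => Finset.sum_congr rfl fun n _ => by ring
    have hswap : ∀ F : ι → κ → κ → κ → ℝ,
        ∑ i, ∑ l, ∑ m, ∑ n, F i l m n = ∑ l, ∑ m, ∑ n, ∑ i, F i l m n := by
      intro F
      rw [Finset.sum_comm]
      refine Finset.sum_congr rfl fun l _ => ?_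
      rw [Finset.sum_comm]
      exact Finset.sum_congr rfl fun m _ => Finset.sum_comm
    simp only [hcube, hswap, hT, Finset.sum_mul_sum]
  -- Contracting two indices of `T` gives `c w`, since every vector has squared length `c`.
  have hTw : ∀ l, ∑ m, T l m m = c * w l := by
    intro l
    simp only [hT, hw]
    rw [Finset.sum_comm, Finset.mul_sum]
    refine Finset.sum_congr rfl fun i _ => ?_
    rw [← hx i, Finset.sum_mul]
    exact Finset.sum_congr rfl fun m _ => by ring
  have hTw' : ∀ l, ∑ m, T m l m = c * w l := by
    intro l
    rw [← hTw l]
    exact Finset.sum_congr rfl fun m _ => Finset.sum_congr rfl fun i _ => by ring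
  have hTw'' : ∀ l, ∑ m, T m m l = c * w l := by
    intro l
    rw [← hTw l]
    exact Finset.sum_congr rfl fun m _ => Finset.sum_congr rfl fun i _ => by ring
  -- The symmetrization of `3 w ⊗ δ` has squared norm `3 (D + 2) W` and inner product `3 c W` with
  -- `T`, so `c / (D + 2)` is the coefficient of the projection.
  have key : 0 ≤ ∑ l, ∑ m, ∑ n,
      ((D + 2) * T l m n - c * (w l * δ m n + w m * δ l n + w n * δ l m)) ^ 2 := by positivity
  have hexp : ∑ l, ∑ m, ∑ n,
      ((D + 2) * T l m n - c * (w l * δ m n + w m * δ l n + w n * δ l m)) ^ 2 =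
      (D + 2) * ((D + 2) * (∑ l, ∑ m, ∑ n, T l m n * T l m n) - 3 * c ^ 2 * W) := by
    have hA₁ : ∑ l, ∑ m, ∑ n, T l m n * (w l * δ m n) = c * W := by
      simp only [δ, mul_ite, mul_one, mul_zero, Finset.sum_ite_eq, Finset.mem_univ, if_true,
        ← Finset.sum_mul, hTw, hW, Finset.mul_sum, mul_assoc]
    have hA₂ : ∑ l, ∑ m, ∑ n, T l m n * (w m * δ l n) = c * W := by
      rw [Finset.sum_comm]
      simp only [δ, mul_ite, mul_one, mul_zero, Finset.sum_ite_eq, Finset.mem_univ, if_true,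
        ← Finset.sum_mul, hTw', hW, Finset.mul_sum, mul_assoc]
    have hA₃ : ∑ l, ∑ m, ∑ n, T l m n * (w n * δ l m) = c * W := by
      have : ∀ l, ∑ m, ∑ n, T l m n * (w n * δ l m) = ∑ n, T l l n * w n := by
        intro l
        rw [Finset.sum_comm]
        simp [δ]
      simp only [this]
      rw [Finset.sum_comm]
      simp only [← Finset.sum_mul, hTw'', hW, Finset.mul_sum, mul_assoc]
    have hB₁ : ∑ l, ∑ m, ∑ n, w l * w l * (δ m n * δ m n) = D * W := by
      simp [δ, hW, hD, ← Finset.mul_sum]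
    have hB₂ : ∑ l, ∑ m, ∑ n, w m * w m * (δ l n * δ l n) = D * W := by
      simp [δ, hW, hD]
    have hB₃ : ∑ l, ∑ m, ∑ n, w n * w n * (δ l m * δ l m) = D * W := by
      simp [δ, hW, hD]
    have hC₁ : ∑ l, ∑ m, ∑ n, w l * w m * (δ m n * δ l n) = W := by
      simp [δ, hW]
    have hC₂ : ∑ l, ∑ m, ∑ n, w l * w n * (δ m n * δ l m) = W := by
      simp [δ, hW]
    have hC₃ : ∑ l, ∑ m, ∑ n, w m * w n * (δ l n * δ l m) = W := by
      simp [δ, hW]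
    have hpt : ∀ l m n,
        ((D + 2) * T l m n - c * (w l * δ m n + w m * δ l n + w n * δ l m)) ^ 2 =
        (D + 2) ^ 2 * (T l m n * T l m n)
          - 2 * c * (D + 2) * (T l m n * (w l * δ m n))
          - 2 * c * (D + 2) * (T l m n * (w m * δ l n))
          - 2 * c * (D + 2) * (T l m n * (w n * δ l m))
          + c ^ 2 * (w l * w l * (δ m n * δ m n))
          + c ^ 2 * (w m * w m * (δ l n * δ l n))
          + c ^ 2 * (w n * w n * (δ l m * δ l m))
          + 2 * c ^ 2 * (w l * w m * (δ m n * δ l n))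
          + 2 * c ^ 2 * (w l * w n * (δ m n * δ l m))
          + 2 * c ^ 2 * (w m * w n * (δ l n * δ l m)) := fun l m n => by ring
    simp only [hpt, Finset.sum_add_distrib, Finset.sum_sub_distrib, ← Finset.mul_sum]
    simp only [← Finset.mul_sum] at hB₁ hB₂ hC₁
    rw [hA₁, hA₂, hA₃, hB₁, hB₂, hB₃, hC₁, hC₂, hC₃]
    ring
  rw [hexp, hTT] at key
  rw [hgram]
  have hD0 : 0 < D + 2 := by positivity
  have := nonneg_of_mul_nonneg_right key hD0
  linarith

/-- Positivity of the third Gegenbauer kernel on a sphere of squared radius `c`. -/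
theorem three_mul_sum_inner_le {ι E : Type*} [Fintype ι] [NormedAddCommGroup E]
    [InnerProductSpace ℝ E] [FiniteDimensional ℝ E] (x : ι → E) (c : ℝ)
    (hx : ∀ i, ‖x i‖ ^ 2 = c) :
    3 * c ^ 2 * ∑ i, ∑ j, inner ℝ (x i) (x j) ≤
      (Module.finrank ℝ E + 2) * ∑ i, ∑ j, (inner ℝ (x i) (x j)) ^ 3 := by
  have hin : ∀ i j, ∑ l, inner ℝ (x i) (stdOrthonormalBasis ℝ E l) *
      inner ℝ (x j) (stdOrthonormalBasis ℝ E l) = inner ℝ (x i) (x j) := by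
    intro i j
    rw [← (stdOrthonormalBasis ℝ E).sum_inner_mul_inner (x i) (x j)]
    exact Finset.sum_congr rfl fun l _ => by rw [real_inner_comm (x j)]
  have := three_mul_sum_dotProduct_le
    (fun i l => inner ℝ (x i) (stdOrthonormalBasis ℝ E l)) c
    (fun i => by rw [hin, real_inner_self_eq_norm_sq, hx])
  simpa only [hin, Fintype.card_fin] using this

/-- A bound for two-distance sets on the sphere of squared radius `a² - 1` in dimension
`3a² - 5`, with inner products `a - 1` and `-(a + 1)`: at these values `t³ - (a² - 1) t` equals
`-2(a - 1)²` and `-2(a + 1)²`, which the diagonal value `(a² - 1)²(a² - 2)` has to make up for. -/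
theorem two_mul_card_sub_one_le {ι E : Type*} [Fintype ι] [Nonempty ι] [NormedAddCommGroup E]
    [InnerProductSpace ℝ E] [FiniteDimensional ℝ E] {a : ℝ} (ha : 1 < a)
    (hd : (Module.finrank ℝ E : ℝ) = 3 * a ^ 2 - 5) (q : ι → E)
    (hq : ∀ i, ‖q i‖ ^ 2 = a ^ 2 - 1)
    (hqq : ∀ i j, i ≠ j → inner ℝ (q i) (q j) = a - 1 ∨ inner ℝ (q i) (q j) = -(a + 1)) :
    2 * ((Fintype.card ι : ℝ) - 1) ≤ (a ^ 2 - 2) * (a + 1) ^ 2 := by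
  classical
  have h := three_mul_sum_inner_le q (a ^ 2 - 1) hq
  have ha2 : 0 < a ^ 2 - 1 := by nlinarith
  have hnonneg : 0 ≤ ∑ i, ∑ j, ((inner ℝ (q i) (q j)) ^ 3 - (a ^ 2 - 1) * inner ℝ (q i) (q j)) := by
    simp only [Finset.sum_sub_distrib, ← Finset.mul_sum]
    rw [hd] at h
    refine nonneg_of_mul_nonneg_right (a := 3 * (a ^ 2 - 1)) ?_ (by positivity)
    linarith
  have hle : ∀ i j, (inner ℝ (q i) (q j)) ^ 3 - (a ^ 2 - 1) * inner ℝ (q i) (q j) ≤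
      (if i = j then (a ^ 2 - 1) ^ 2 * (a ^ 2 - 2) + 2 * (a - 1) ^ 2 else 0)
        - 2 * (a - 1) ^ 2 := by
    intro i j
    split_ifs with hij
    · subst hij
      rw [real_inner_self_eq_norm_sq, hq]
      exact le_of_eq (by ring)
    · rcases hqq i j hij with h | h <;> rw [h]
      · exact le_of_eq (by ring)
      · nlinarith
  have hsum := hnonneg.trans (Finset.sum_le_sum fun i _ => Finset.sum_le_sum fun j _ => hle i j)
  simp only [Finset.sum_sub_distrib, Finset.sum_ite_eq, Finset.mem_univ, if_true,
    Finset.sum_const, Finset.card_univ, nsmul_eq_mul] at hsum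
  have hN : (0 : ℝ) < Fintype.card ι := by exact_mod_cast Fintype.card_pos
  have ha1 : 0 < (a - 1) ^ 2 := by have := sub_pos.2 ha; positivity
  have h2 : 0 ≤ ((Fintype.card ι : ℝ) * (a - 1) ^ 2) *
      ((a ^ 2 - 2) * (a + 1) ^ 2 - 2 * ((Fintype.card ι : ℝ) - 1)) := by linarith
  have := nonneg_of_mul_nonneg_right h2 (by positivity)
  linarith

theorem Submodule.exists_mem_norm_eq_one {E : Type*} [NormedAddCommGroup E] [NormedSpace ℝ E]
    {l : Submodule ℝ E} (hl : Module.finrank ℝ l = 1) : ∃ v ∈ l, ‖v‖ = 1 := by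
  have hne : l ≠ ⊥ := by
    rintro rfl
    rw [finrank_bot] at hl
    exact zero_ne_one hl
  obtain ⟨v, hv, hv0⟩ := l.exists_mem_ne_zero_of_ne_bot hne
  exact ⟨_, l.smul_mem _ hv, norm_smul_inv_norm (𝕜 := ℝ) hv0⟩

/-- On a line at angle `arccos α` to the unit vector `z`, one of the two unit vectors has
inner product `α` with `z`. -/
theorem exists_unit_inner_eq {n : ℕ} {α : ℝ}
    {L : Set (Submodule ℝ (EuclideanSpace ℝ (Fin n)))} (hL : IsEquiangularLineSystem n α L)
    {l₀ l : Submodule ℝ (EuclideanSpace ℝ (Fin n))} (h₀ : l₀ ∈ L) (hl : l ∈ L) (hne : l ≠ l₀)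
    {z : EuclideanSpace ℝ (Fin n)} (hz : z ∈ l₀) (hz1 : ‖z‖ = 1) :
    ∃ u ∈ l, ‖u‖ = 1 ∧ inner ℝ u z = α := by
  obtain ⟨v, hv, hv1⟩ := Submodule.exists_mem_norm_eq_one (hL.1 l hl)
  have habs := hL.2 l hl l₀ h₀ hne v hv z hz hv1 hz1
  rcases abs_choice (inner ℝ v z) with h | h
  · exact ⟨v, hv, hv1, by rw [← h, habs]⟩
  · exact ⟨-v, l.neg_mem hv, by rw [norm_neg, hv1], by rw [inner_neg_left, ← h, habs]⟩

/-- Any finite part of an equiangular line system with angle `arccos (1 / a)` in dimension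
`3a² - 4` obeys the bound, provided that it has at least two lines. -/
theorem IsEquiangularLineSystem.two_mul_card_sub_two_le {n : ℕ} {a : ℝ} (ha : 1 < a)
    (hn : (n : ℝ) = 3 * a ^ 2 - 4) {L : Set (Submodule ℝ (EuclideanSpace ℝ (Fin n)))}
    (hL : IsEquiangularLineSystem n (1 / a) L)
    (s : Finset (Submodule ℝ (EuclideanSpace ℝ (Fin n)))) (hs : (s : Set _) ⊆ L)
    (hcard : 2 ≤ s.card) :
    2 * ((s.card : ℝ) - 2) ≤ (a ^ 2 - 2) * (a + 1) ^ 2 := by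
  classical
  have ha0 : a ≠ 0 := by positivity
  obtain ⟨l₀, hl₀⟩ : s.Nonempty := Finset.card_pos.1 (by omega)
  obtain ⟨z, hz, hz1⟩ := Submodule.exists_mem_norm_eq_one (hL.1 l₀ (hs hl₀))
  have hmem : ∀ l : s.erase l₀, (l : Submodule ℝ (EuclideanSpace ℝ (Fin n))) ∈ L :=
    fun l => hs (Finset.mem_of_mem_erase l.2)
  choose u hul hu1 huz using fun l : s.erase l₀ =>
    exists_unit_inner_eq hL (hs hl₀) (hmem l) (Finset.ne_of_mem_erase l.2) hz hz1
  have hzz : inner ℝ z z = (1 : ℝ) := by rw [real_inner_self_eq_norm_sq, hz1, one_pow]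
  have hinner : ∀ i j, inner ℝ (a • u i - z) (a • u j - z) = a ^ 2 * inner ℝ (u i) (u j) - 1 := by
    intro i j
    simp only [inner_sub_left, inner_sub_right, real_inner_smul_left, real_inner_smul_right, hzz,
      huz, real_inner_comm (u j) z]
    field_simp
    ring
  have horth : ∀ i, a • u i - z ∈ (Submodule.span ℝ {z})ᗮ := by
    intro i
    rw [Submodule.mem_orthogonal_singleton_iff_inner_left, inner_sub_left, real_inner_smul_left,
      huz, hzz]
    field_simp
    ring
  have hfin : (Module.finrank ℝ (Submodule.span ℝ {z})ᗮ : ℝ) = 3 * a ^ 2 - 5 := by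
    have hz0 : z ≠ 0 := norm_ne_zero_iff.1 (by rw [hz1]; exact one_ne_zero)
    have h := (Submodule.span ℝ {z}).finrank_add_finrank_orthogonal
    rw [finrank_span_singleton hz0, finrank_euclideanSpace_fin] at h
    have h' : (1 : ℝ) + Module.finrank ℝ (Submodule.span ℝ {z})ᗮ = n := by exact_mod_cast h
    linarith
  have hcard' : Fintype.card (s.erase l₀) = s.card - 1 := by
    rw [Fintype.card_coe, Finset.card_erase_of_mem hl₀]
  have : Nonempty (s.erase l₀) := Fintype.card_pos_iff.1 (by omega)
  have h := two_mul_card_sub_one_le ha hfin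
    (fun i : s.erase l₀ => (⟨a • u i - z, horth i⟩ : (Submodule.span ℝ {z})ᗮ))
    (fun i => by
      rw [← real_inner_self_eq_norm_sq, Submodule.coe_inner, hinner, real_inner_self_eq_norm_sq,
        hu1]
      ring)
    (fun i j hij => by
      rw [Submodule.coe_inner, hinner]
      have habs := hL.2 i (hmem i) j (hmem j) (Subtype.coe_ne_coe.2 hij) _ (hul i) _ (hul j)
        (hu1 i) (hu1 j)
      rcases eq_or_eq_neg_of_abs_eq habs with h | h <;> rw [h]
      · left; field_simp
      · right; field_simp; ring)
  rw [hcard', Nat.cast_sub (by omega)] at h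
  push_cast at h
  linarith

theorem corollary2p2 (k : ℕ) (hk : 2 ≤ k) :
    cosSeq k = 1 / (2 * (k : ℝ) - 1) ∧
    (∃ m : ℕ, maxEquiangularLines (cosSeq k) (dimSeq k) = (m : ℕ∞) ∧
      (m : ℝ) ≤ 2 * ((k : ℝ) - 1) * (4 * (k : ℝ) ^ 3 - (k : ℝ) - 1)) ∧
    2 * ((k : ℝ) - 1) * (4 * (k : ℝ) ^ 3 - (k : ℝ) - 1) <
      ((dimSeq k : ℝ) + 1) * ((dimSeq k : ℝ) + 2) / 6 := by
  have hk' : (2 : ℝ) ≤ k := by exact_mod_cast hk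
  have hdim : (dimSeq k : ℝ) = 3 * (2 * (k : ℝ) - 1) ^ 2 - 4 := by
    have h1 : 1 ≤ 2 * k := by omega
    have h2 : 4 ≤ 3 * (2 * k - 1) ^ 2 := by
      have : 3 ≤ 2 * k - 1 := by omega
      nlinarith
    rw [dimSeq, Nat.cast_sub h2]
    push_cast [Nat.cast_sub h1]
    ring
  have hcos : cosSeq k = 1 / (2 * (k : ℝ) - 1) := by
    have hpos : (0 : ℝ) < 2 * k - 1 := by linarith
    rw [cosSeq, hdim, Real.sqrt_eq_iff_mul_self_eq_of_pos (by positivity)]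
    field_simp
    ring
  refine ⟨hcos, ?_, ?_⟩
  · set B : ℕ := 2 * (k - 1) * (4 * k ^ 3 - k - 1) with hB
    have hBcast : (B : ℝ) = 2 * ((k : ℝ) - 1) * (4 * (k : ℝ) ^ 3 - (k : ℝ) - 1) := by
      have h1 : 1 ≤ k := by omega
      have h3 : k + 1 ≤ 4 * k ^ 3 := by nlinarith [Nat.pow_le_pow_left hk 2]
      rw [hB, Nat.sub_sub]
      push_cast [Nat.cast_sub h1, Nat.cast_sub h3]
      ring
    have hle : maxEquiangularLines (cosSeq k) (dimSeq k) ≤ (B : ℕ∞) := by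
      refine iSup₂_le fun L hL => ?_
      by_contra! hlt
      obtain ⟨t, htL, ht⟩ := Set.exists_subset_encard_eq (Order.add_one_le_of_lt hlt)
      have htfin : t.Finite := Set.finite_of_encard_eq_coe (k := B + 1) (by simpa using ht)
      have htcard : htfin.toFinset.card = B + 1 := by
        rw [htfin.encard_eq_coe_toFinset_card] at ht
        exact_mod_cast ht
      have hB1 : (1 : ℝ) ≤ B := by rw [hBcast]; nlinarith [pow_le_pow_left₀ (by norm_num) hk' 3]
      have hB1' : 1 ≤ B := by exact_mod_cast hB1
      rw [hcos] at hL
      have hmain := hL.two_mul_card_sub_two_le (by linarith) hdim htfin.toFinset (by simpa using htL)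
        (by omega)
      rw [htcard] at hmain
      push_cast at hmain
      rw [hBcast] at hmain
      nlinarith
    obtain ⟨m, hm, hmB⟩ := ENat.le_natCast_iff.1 hle
    exact ⟨m, hm, by rw [← hBcast]; exact_mod_cast hmB⟩
  · rw [hdim]
    -- With `a = 2k - 1` the difference of the two sides is `a (a - 1) (a² - 2)`.
    have h : 0 < (2 * (k : ℝ) - 1) * ((2 * k - 1) - 1) * ((2 * k - 1) ^ 2 - 2) := by
      have h1 : (0 : ℝ) < 2 * k - 1 := by linarith
      have h2 : (0 : ℝ) < (2 * k - 1) - 1 := by linarith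
      have h3 : (0 : ℝ) < (2 * k - 1) ^ 2 - 2 := by nlinarith
      positivity
    nlinarith
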